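/- Let $(X,\mathrm{dist})$ be a metric space whose points are colored with $m$ colors, let $k_1,\dots,k_m\ge 0$ be integers and $k=\sum_i k_i$. For a finite set $S\subseteq X$ let $\mathrm{div}(S)=\sum_{p\in S}\min_{q\in S\setminus\{p\}}\mathrm{dist}(p,q)$ be its sum-of-nearest-neighbor diversity (with value $0$ if $|S|\le 1$), and for a finite $P\subseteq X$ let $\mathrm{div}_{k_1,\dots,k_m}(P)$ be the maximum of $\mathrm{div}(S)$ over all $S\subseteq P$ that contain exactly $k_i$ points of color $i$ for every $i$; $P$ is called feasible if such an $S$ exists. GMM on a finite set $Q$ with $t$ iterations starts with an arbitrary point of $Q$ and in each further iteration adds a point of $Q$ whose distance to the set of points chosen so far is largest, ties being broken arbitrarily (it returns $\emptyset$ if $Q=\emptyset$, and all of $Q$ if $|Q|\le t$). The single-color construction on $Q$ performs $k$ rounds; each round runs GMM with $k+1$ iterations on the current set, stores the returned points and removes them from the current set; the output is the set of all stored points. For a finite $P\subseteq X$ (a part), let $\mathcal A(P)$ be the union of outputs of the single-color construction on the color classes of $P$. Then there are absolute constants $C_1,C_2>0$ such that for all such data, and for all choices made in GMM, the following holds. The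 algorithm always has an output; for every finite $P\subseteq X$ one has $\mathcal A(P)\subseteq P$ and $|\mathcal A(P)|\le C_1\,m\,k^2$; and $\mathcal A$ is a fully composable core-set with approximation factor $O(m\log k)$: for every $N$ and all finite $P^{(1)},\dots,P^{(N)}\subseteq X$ (not necessarily disjoint) whose union is feasible, $\bigcup_j\mathcal A(P^{(j)})$ is feasible and $$\mathrm{div}_{k_1,\dots,k_m}\Big(\bigcup_{j\le N}P^{(j)}\Big)\le C_2\,m\log k\cdot \mathrm{div}_{k_1,\dots,k_m}\Big(\bigcup_{j\le N}\mathcal A(P^{(j)})\Big)$$ (for $k\le 1$ both diversities are $0$, and the factor is read as $0$). -/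

import Mathlib

open Finset

namespace FairDiversity

variable {X : Type*} [MetricSpace X] [DecidableEq X]

/-- The sum-of-nearest-neighbor diversity `∑_{p ∈ S} min_{q ∈ S \ {p}} dist p q`.
`Metric.infDist` to a finite nonempty set is the minimum of the distances. A one-point set has
diversity `0`, because `Metric.infDist` to the empty set is `0`. -/
noncomputable def sumNN (S : Finset X) : ℝ :=
  ∑ p ∈ S, Metric.infDist p (S.erase p : Set X)

/-- The points of color `i` in the point set `P`. -/
def colorClass {m : ℕ} (c : X → Fin m) (P : Finset X) (i : Fin m) : Finset X :=
  P.filter (fun x => c x = i)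

/-- `S ⊆ P` has exactly `κ i` points of each color `i`. -/
def IsFairSelection {m : ℕ} (c : X → Fin m) (κ : Fin m → ℕ) (P S : Finset X) : Prop :=
  S ⊆ P ∧ ∀ i, (colorClass c S i).card = κ i

/-- The optimal fair diversity: the maximum of `sumNN S` over all fair selections `S` from `P`.
It is only meaningful if a fair selection exists (see `fairDiv_isGreatest`). -/
noncomputable def fairDiv {m : ℕ} (c : X → Fin m) (κ : Fin m → ℕ) (P : Finset X) : ℝ :=
  sSup (sumNN '' {S | IsFairSelection c κ P S})

theorem fairDiv_isGreatest {m : ℕ} (c : X → Fin m) (κ : Fin m → ℕ) (P : Finset X)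
    (h : ∃ S, IsFairSelection c κ P S) :
    IsGreatest (sumNN '' {S | IsFairSelection c κ P S}) (fairDiv c κ P) := by
  have hfin : (sumNN '' {S | IsFairSelection c κ P S}).Finite := by
    apply Set.Finite.image
    apply (Finset.finite_toSet P.powerset).subset
    intro S hS
    exact Finset.mem_coe.2 (Finset.mem_powerset.2 hS.1)
  obtain ⟨S, hS⟩ := h
  have hne : (sumNN '' {S | IsFairSelection c κ P S}).Nonempty := ⟨_, S, hS, rfl⟩
  exact ⟨hne.csSup_mem hfin, fun x hx => le_csSup hfin.bddAbove hx⟩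

/-- `GMMOutput P t G`: the set `G` is a possible output of the greedy farthest-point algorithm
GMM on `P` with `t` iterations. The first point is arbitrary; each further iteration
adds a point of `P` that is farthest from the points chosen so far, with ties broken arbitrarily.
On the empty set GMM returns the empty set. Once every point of `P` is chosen, further iterations
change nothing. -/
inductive GMMOutput (P : Finset X) : ℕ → Finset X → Prop
  | empty (t : ℕ) (hP : P = ∅) : GMMOutput P t ∅
  | first (p : X) (hp : p ∈ P) : GMMOutput P 1 {p}
  | step (t : ℕ) (G : Finset X) (p : X) (hG : GMMOutput P t G) (hp : p ∈ P)
      (hmax : ∀ q ∈ P, Metric.infDist q (G : Set X) ≤ Metric.infDist p (G : Set X)) :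
      GMMOutput P (t + 1) (insert p G)

/-- `RoundsOutput t n P S`: the set `S` is a possible result of `n` rounds on `P`, where each round
runs GMM for `t` iterations on the current point set, stores the points that GMM returns, and
removes them from the current point set. -/
inductive RoundsOutput (t : ℕ) : ℕ → Finset X → Finset X → Prop
  | zero (P : Finset X) : RoundsOutput t 0 P ∅
  | succ (n : ℕ) (P G S : Finset X) (hG : GMMOutput P t G) (hS : RoundsOutput t n (P \ G) S) :
      RoundsOutput t (n + 1) P (G ∪ S)

/-- Possible outputs of the single-color core-set construction for sum-of-nearest-neighbor
diversity: `k` rounds of GMM without replacement, each with `k + 1` iterations. -/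
def ColorCoresetOutput (k : ℕ) (P S : Finset X) : Prop :=
  RoundsOutput (k + 1) k P S

/-- Possible outputs on a colored point set: run the single-color construction on every color
class and take the union. -/
def UnionCoresetOutput {m : ℕ} (c : X → Fin m) (k : ℕ) (P T : Finset X) : Prop :=
  ∃ S : Fin m → Finset X,
    (∀ i, ColorCoresetOutput k (colorClass c P i) (S i)) ∧ T = univ.biUnion S

/-- A summarization algorithm (`A P T` means that `T` is a possible output on the part `P`)
constructs an `α`-approximate fully composable core-set: for any finite collection of colored point
sets, each summarized separately, whenever the union of the point sets
admits a fair selection so does the union of the summaries, and its optimal fair diversity is at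
least a `1 / α` fraction of that of the union of the point sets. -/
def IsFullyComposable {m : ℕ} (c : X → Fin m) (κ : Fin m → ℕ)
    (A : Finset X → Finset X → Prop) (α : ℝ) : Prop :=
  ∀ (N : ℕ) (P T : Fin N → Finset X), (∀ j, A (P j) (T j)) →
    (∃ S, IsFairSelection c κ (univ.biUnion P) S) →
      (∃ S, IsFairSelection c κ (univ.biUnion T) S) ∧
        fairDiv c κ (univ.biUnion P) ≤ α * fairDiv c κ (univ.biUnion T)

end FairDiversity

namespace FairDiversity

variable {X : Type*} [MetricSpace X] [DecidableEq X]

/-! Fix an optimal selection `S` and a scale `r`. By greediness, the summaries give each color one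
of two certificates: `k + 1` stored points pairwise at least `r / 4` apart, or `k` stored points
within `r / 4` of every discarded point of that color. Under the second, each point of `S` stays or
moves by less than `r / 4` to an unused stored point. Points of the other colors are then placed
greedily, at least `r / 8` from all other chosen points. The new selection is fair, and points whose
nearest-neighbor distance was at least `r` keep at least `r / 8`
(`exists_fair_selection_of_coresets`).

So at every scale `r` times the number of such points is at most `8` times the core-set optimum.
Hence the `j`-th largest nearest-neighbor distance is at most that bound divided by `j`, and summing
(`sum_le_mul_harmonic`) costs a harmonic number, which is `O(log k)`. The colors share a single
scale, so no factor `m` arises. -/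

theorem sumNN_nonneg (S : Finset X) : 0 ≤ sumNN S :=
  Finset.sum_nonneg fun _ _ => Metric.infDist_nonneg

theorem sumNN_eq_zero_of_card_le_one {S : Finset X} (h : S.card ≤ 1) : sumNN S = 0 := by
  refine Finset.sum_eq_zero fun p hp => ?_
  have hS : S.erase p = ∅ := by
    rw [← Finset.card_eq_zero, Finset.card_erase_of_mem hp]
    omega
  have : ((S.erase p : Finset X) : Set X) = ∅ := by rw [hS, Finset.coe_empty]
  rw [this, Metric.infDist_empty]

/-! ### The greedy farthest-point algorithm -/

theorem GMMOutput.subset {P G : Finset X} {t : ℕ} (h : GMMOutput P t G) : G ⊆ P := by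
  induction h with
  | empty t hP => exact Finset.empty_subset _
  | first p hp => exact Finset.singleton_subset_iff.2 hp
  | step t G p hG hp hmax ih => exact Finset.insert_subset hp ih

theorem GMMOutput.card_le {P G : Finset X} {t : ℕ} (h : GMMOutput P t G) : G.card ≤ t := by
  induction h with
  | empty t hP => simp
  | first p hp => simp
  | step t G p hG hp hmax ih => exact (Finset.card_insert_le _ _).trans (by omega)

theorem GMMOutput.exists_output (P : Finset X) (t : ℕ) : ∃ G, GMMOutput P (t + 1) G := by
  rcases P.eq_empty_or_nonempty with hP | hP
  · exact ⟨∅, .empty _ hP⟩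
  induction t with
  | zero =>
    obtain ⟨p, hp⟩ := hP
    exact ⟨{p}, .first p hp⟩
  | succ t ih =>
    obtain ⟨G, hG⟩ := ih
    obtain ⟨p, hp, hmax⟩ := P.exists_max_image (fun q => Metric.infDist q (G : Set X)) hP
    exact ⟨insert p G, .step _ G p hG hp hmax⟩

/-- At every scale `δ`, the output of GMM is a `δ`-net of the input or consists of `t` points with
pairwise distances at least `δ`. -/
theorem GMMOutput.cover_or_separated {P G : Finset X} {t : ℕ} (h : GMMOutput P t G) {δ : ℝ}
    (hδ : 0 < δ) :
    (∀ q ∈ P, ∃ y ∈ G, dist q y < δ) ∨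
      (G.card = t ∧ ∀ x ∈ G, ∀ y ∈ G, x ≠ y → δ ≤ dist x y) := by
  induction h with
  | empty t hP => simp [hP]
  | first p hp =>
    refine .inr ⟨Finset.card_singleton p, fun x hx y hy hxy => ?_⟩
    rw [Finset.mem_singleton] at hx hy
    exact absurd (hx.trans hy.symm) hxy
  | step t G p hG hp hmax ih =>
    rcases ih with ih | ⟨hcard, hsep⟩
    · left
      intro q hq
      obtain ⟨y, hy, hqy⟩ := ih q hq
      exact ⟨y, Finset.mem_insert_of_mem hy, hqy⟩
    by_cases hcov : ∀ q ∈ P, ∃ y ∈ G, dist q y < δ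
    · left
      intro q hq
      obtain ⟨y, hy, hqy⟩ := hcov q hq
      exact ⟨y, Finset.mem_insert_of_mem hy, hqy⟩
    right
    push Not at hcov
    obtain ⟨q, hq, hfar⟩ := hcov
    -- The uncovered `q` competes with `p`, which is farthest from `G`.
    have hpfar : ∀ y ∈ G, δ ≤ dist p y := by
      intro y hy
      have h1 : δ ≤ Metric.infDist q (G : Set X) :=
        (Metric.le_infDist ⟨y, hy⟩).2 fun {z} hz => hfar z hz
      exact (h1.trans (hmax q hq)).trans (Metric.infDist_le_dist_of_mem hy)
    have hpG : p ∉ G := fun hmem => by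
      have := hpfar p hmem
      rw [dist_self] at this
      linarith
    refine ⟨by rw [Finset.card_insert_of_notMem hpG, hcard], fun x hx y hy hxy => ?_⟩
    rcases Finset.mem_insert.1 hx with hxp | hxG
    · rw [hxp] at hxy ⊢
      exact hpfar y (Finset.mem_of_mem_insert_of_ne hy hxy.symm)
    rcases Finset.mem_insert.1 hy with hyp | hyG
    · rw [hyp, dist_comm]
      exact hpfar x hxG
    · exact hsep x hxG y hyG hxy

/-! ### Repeated rounds -/

theorem RoundsOutput.subset {P S : Finset X} {t n : ℕ} (h : RoundsOutput t n P S) : S ⊆ P := by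
  induction h with
  | zero P => exact Finset.empty_subset _
  | succ n P G S hG hS ih =>
    exact Finset.union_subset hG.subset (ih.trans Finset.sdiff_subset)

theorem RoundsOutput.card_le {P S : Finset X} {t n : ℕ} (h : RoundsOutput t n P S) :
    S.card ≤ n * t := by
  induction h with
  | zero P => simp
  | succ n P G S hG hS ih =>
    calc (G ∪ S).card ≤ G.card + S.card := Finset.card_union_le _ _
      _ ≤ t + n * t := Nat.add_le_add hG.card_le ih
      _ = (n + 1) * t := by ring

theorem RoundsOutput.exists_output (t n : ℕ) (P : Finset X) :
    ∃ S, RoundsOutput (t + 1) n P S := by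
  induction n generalizing P with
  | zero => exact ⟨∅, .zero P⟩
  | succ n ih =>
    obtain ⟨G, hG⟩ := GMMOutput.exists_output P t
    obtain ⟨S, hS⟩ := ih (P \ G)
    exact ⟨G ∪ S, .succ n P G S hG hS⟩

/-- At every scale `δ`, the stored points contain `t` points with pairwise distances at least `δ`,
or every discarded point has one stored point per round at distance less than `δ`. -/
theorem RoundsOutput.separated_or_close {P S : Finset X} {t n : ℕ} (h : RoundsOutput t n P S)
    {δ : ℝ} (hδ : 0 < δ) :
    (∃ G ⊆ S, G.card = t ∧ ∀ x ∈ G, ∀ y ∈ G, x ≠ y → δ ≤ dist x y) ∨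
      ∀ p ∈ P, p ∉ S → ∃ Y ⊆ S, Y.card = n ∧ ∀ y ∈ Y, dist p y < δ := by
  induction h with
  | zero P => exact .inr fun p _ _ => ⟨∅, Finset.Subset.rfl, rfl, by simp⟩
  | succ n P G S hG hS ih =>
    rcases ih with ⟨H, hH, hsep⟩ | ih
    · exact .inl ⟨H, hH.trans Finset.subset_union_right, hsep⟩
    rcases hG.cover_or_separated hδ with hcov | hsep
    · right
      intro p hp hpGS
      rw [Finset.mem_union, not_or] at hpGS
      obtain ⟨Y, hYS, hYn, hY⟩ := ih p (Finset.mem_sdiff.2 ⟨hp, hpGS.1⟩) hpGS.2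
      obtain ⟨y, hyG, hy⟩ := hcov p hp
      -- Later rounds run on `P \ G`, so different rounds supply different points.
      have hyY : y ∉ Y := fun hmem => (Finset.mem_sdiff.1 (hS.subset (hYS hmem))).2 hyG
      refine ⟨insert y Y, Finset.insert_subset (Finset.mem_union_left _ hyG)
        (hYS.trans Finset.subset_union_right), by rw [Finset.card_insert_of_notMem hyY, hYn], ?_⟩
      intro z hz
      rcases Finset.mem_insert.1 hz with rfl | hz
      · exact hy
      · exact hY z hz
    · exact .inl ⟨G, Finset.subset_union_left, hsep⟩

/-! ### Colored point sets -/

theorem mem_colorClass {Y : Type*} {m : ℕ} {c : Y → Fin m} {P : Finset Y} {i : Fin m} {x : Y} :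
    x ∈ colorClass c P i ↔ x ∈ P ∧ c x = i := Finset.mem_filter

theorem UnionCoresetOutput.exists_output {m : ℕ} (c : X → Fin m) (k : ℕ) (P : Finset X) :
    ∃ T, UnionCoresetOutput c k P T := by
  choose S hS using fun i => RoundsOutput.exists_output k k (colorClass c P i)
  exact ⟨_, S, hS, rfl⟩

theorem UnionCoresetOutput.subset {m : ℕ} {c : X → Fin m} {k : ℕ} {P T : Finset X}
    (h : UnionCoresetOutput c k P T) : T ⊆ P := by
  obtain ⟨S, hS, rfl⟩ := h
  exact Finset.biUnion_subset.2 fun i _ => (hS i).subset.trans (Finset.filter_subset _ _)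

theorem UnionCoresetOutput.card_le {m : ℕ} {c : X → Fin m} {k : ℕ} {P T : Finset X}
    (h : UnionCoresetOutput c k P T) : T.card ≤ m * (k * (k + 1)) := by
  obtain ⟨S, hS, rfl⟩ := h
  simpa using Finset.card_biUnion_le_card_mul univ S _ fun i _ => (hS i).card_le

theorem UnionCoresetOutput.separated_or_close {m : ℕ} {c : X → Fin m} {k : ℕ} {P T : Finset X}
    (h : UnionCoresetOutput c k P T) {δ : ℝ} (hδ : 0 < δ) (i : Fin m) :
    (∃ G ⊆ colorClass c T i, G.card = k + 1 ∧ ∀ x ∈ G, ∀ y ∈ G, x ≠ y → δ ≤ dist x y) ∨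
      ∀ p ∈ P, c p = i → p ∉ T →
        ∃ Y ⊆ colorClass c T i, Y.card = k ∧ ∀ y ∈ Y, dist p y < δ := by
  obtain ⟨S, hS, rfl⟩ := h
  have hsub : S i ⊆ colorClass c (univ.biUnion S) i := fun x hx =>
    mem_colorClass.2 ⟨Finset.mem_biUnion.2 ⟨i, Finset.mem_univ i, hx⟩,
      (mem_colorClass.1 ((hS i).subset hx)).2⟩
  rcases (hS i).separated_or_close hδ with ⟨G, hG, hsep⟩ | hclose
  · exact .inl ⟨G, hG.trans hsub, hsep⟩
  · right
    intro p hp hpi hpT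
    obtain ⟨Y, hY, hcard⟩ := hclose p (mem_colorClass.2 ⟨hp, hpi⟩) fun hmem =>
      hpT (Finset.mem_biUnion.2 ⟨i, Finset.mem_univ i, hmem⟩)
    exact ⟨Y, hY.trans hsub, hcard⟩

theorem IsFairSelection.card_eq {Y : Type*} {m : ℕ} {c : Y → Fin m} {κ : Fin m → ℕ}
    {P S : Finset Y} (h : IsFairSelection c κ P S) : S.card = ∑ i, κ i := by
  rw [Finset.card_eq_sum_card_fiberwise (f := c) (t := univ)
    fun _ _ => Finset.mem_coe.2 (mem_univ _)]
  exact Finset.sum_congr rfl fun i _ => h.2 i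

theorem IsFairSelection.image {Y : Type*} [DecidableEq Y] {m : ℕ} {c : Y → Fin m} {κ : Fin m → ℕ}
    {P Q S : Finset Y}
    (h : IsFairSelection c κ P S) {g : Y → Y} (hg : Set.InjOn g S) (hc : ∀ p ∈ S, c (g p) = c p)
    (hQ : ∀ p ∈ S, g p ∈ Q) : IsFairSelection c κ Q (S.image g) := by
  refine ⟨Finset.image_subset_iff.2 hQ, fun i => ?_⟩
  have : colorClass c (S.image g) i = (colorClass c S i).image g := by
    ext y
    simp only [mem_colorClass, Finset.mem_image]
    constructor
    · rintro ⟨⟨p, hp, rfl⟩, hi⟩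
      exact ⟨p, ⟨hp, (hc p hp).symm.trans hi⟩, rfl⟩
    · rintro ⟨p, ⟨hp, hi⟩, rfl⟩
      exact ⟨⟨p, hp, rfl⟩, (hc p hp).trans hi⟩
  rw [this, Finset.card_image_of_injOn
    (hg.mono fun x hx => (mem_colorClass.1 (Finset.mem_coe.1 hx)).1)]
  exact h.2 i

/-! ### Greedy choice of representatives -/

/-- Greedy extension: if every point of `A` has a `C`-candidate in relation `D` with any fewer than
`n` given points, then an assignment on `W` extends to `W ∪ A`. -/
theorem exists_greedy_extension {α β : Type*} [DecidableEq α] [DecidableEq β] {D : β → β → Prop}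
    (hD : ∀ x y, D x y → D y x)
    {C : α → β → Prop} {n : ℕ} (W : Finset α) (f : α → β) (A : Finset α) (hWA : Disjoint W A)
    (hcard : W.card + A.card ≤ n)
    (hC : ∀ p ∈ A, ∀ F : Finset β, F.card < n → ∃ y, C p y ∧ ∀ z ∈ F, D y z) :
    ∃ g : α → β, (∀ p ∈ W, g p = f p) ∧
      ∀ p ∈ A, C p (g p) ∧ ∀ q ∈ W ∪ A, q ≠ p → D (g p) (g q) := by
  induction A using Finset.induction_on with
  | empty => exact ⟨f, fun _ _ => rfl, by simp⟩
  | insert a A ha ih =>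
    rw [Finset.card_insert_of_notMem ha] at hcard
    rw [Finset.disjoint_insert_right] at hWA
    obtain ⟨g, hgW, hgA⟩ := ih hWA.2 (by omega) fun p hp =>
      hC p (Finset.mem_insert_of_mem hp)
    have hF : ((W ∪ A).image g).card < n := by
      have h1 := Finset.card_image_le (s := W ∪ A) (f := g)
      have h2 := Finset.card_union_le W A
      omega
    obtain ⟨y, hCy, hDy⟩ := hC a (Finset.mem_insert_self a A) _ hF
    have hold : ∀ q ∈ W ∪ A, Function.update g a y q = g q := fun q hq =>
      Function.update_of_ne (by
        rintro rfl
        rcases Finset.mem_union.1 hq with h | h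
        exacts [hWA.1 h, ha h]) _ _
    have hy : ∀ q ∈ W ∪ A, D y (g q) := fun q hq => hDy _ (Finset.mem_image_of_mem g hq)
    refine ⟨Function.update g a y, fun p hp => ?_, fun p hp => ?_⟩
    · rw [hold p (Finset.mem_union_left _ hp), hgW p hp]
    rcases Finset.mem_insert.1 hp with rfl | hpA
    · rw [Function.update_self]
      refine ⟨hCy, fun q hq hqp => ?_⟩
      have hq' : q ∈ W ∪ A := by
        rw [Finset.union_insert] at hq
        exact Finset.mem_of_mem_insert_of_ne hq hqp
      rw [hold q hq']
      exact hy q hq'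
    · have hpWA : p ∈ W ∪ A := Finset.mem_union_right _ hpA
      rw [hold p hpWA]
      refine ⟨(hgA p hpA).1, fun q hq hqp => ?_⟩
      rw [Finset.union_insert] at hq
      rcases Finset.mem_insert.1 hq with rfl | hq
      · rw [Function.update_self]
        exact hD _ _ (hy p hpWA)
      · rw [hold q hq]
        exact (hgA p hpA).2 q hq hqp

/-- Pigeonhole: each point of `F` is within `δ` of at most one point of `G`. -/
theorem exists_far_of_separated {Y : Type*} [MetricSpace Y] {G F : Finset Y} {δ : ℝ}
    (hFG : F.card < G.card) (hsep : ∀ x ∈ G, ∀ y ∈ G, x ≠ y → 2 * δ ≤ dist x y) :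
    ∃ y ∈ G, ∀ z ∈ F, δ ≤ dist y z := by
  by_contra! hcon
  choose! φ hφ hlt using hcon
  obtain ⟨x, hx, y, hy, hxy, heq⟩ := Finset.exists_ne_map_eq_of_card_lt_of_maps_to hFG hφ
  have h1 := hlt x hx
  have h2 := hlt y hy
  rw [← heq] at h2
  linarith [hsep x hx y hy hxy, dist_triangle_right x y (φ x)]

/-- A fair selection from the parts is replaced by one from the summaries that keeps the number of
points that have nearest-neighbor distance at least `r`, up to a factor in `r`. -/
theorem exists_fair_selection_of_coresets {m : ℕ} {c : X → Fin m} {κ : Fin m → ℕ} {N : ℕ}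
    {P T : Fin N → Finset X} (hT : ∀ j, UnionCoresetOutput c (∑ i, κ i) (P j) (T j))
    {S : Finset X} (hS : IsFairSelection c κ (univ.biUnion P) S) {r : ℝ} (hr : 0 < r) :
    ∃ S', IsFairSelection c κ (univ.biUnion T) S' ∧
      r * ({p ∈ S | r ≤ Metric.infDist p (S.erase p : Set X)}.card : ℝ) ≤ 8 * sumNN S' := by
  classical
  set U := univ.biUnion T with hU
  have hTU : ∀ j, T j ⊆ U := fun j => Finset.subset_biUnion_of_mem T (mem_univ j)
  have hcolor : ∀ j i, colorClass c (T j) i ⊆ colorClass c U i := fun j i =>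
    Finset.filter_subset_filter _ (hTU j)
  -- Separation is tested in the union of all summaries, so one part may certify a color for every
  -- part.
  let large : Fin m → Prop := fun i =>
    ∃ G ⊆ colorClass c U i, G.card = (∑ i, κ i) + 1 ∧
      ∀ x ∈ G, ∀ y ∈ G, x ≠ y → 2 * (r / 8) ≤ dist x y
  have hsmall : ∀ p ∈ S, ¬ large (c p) → p ∉ U →
      ∃ Y ⊆ colorClass c U (c p), Y.card = ∑ i, κ i ∧ ∀ y ∈ Y, dist p y < r / 4 := by
    intro p hp hpl hpU
    obtain ⟨j, -, hpj⟩ := Finset.mem_biUnion.1 (hS.1 hp)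
    rcases (hT j).separated_or_close (δ := r / 4) (by positivity) (c p) with
      ⟨G, hG, hcard, hsep⟩ | hclose
    · refine absurd ⟨G, hG.trans (hcolor j _), hcard, fun x hx y hy hxy => ?_⟩ hpl
      linarith [hsep x hx y hy hxy]
    · obtain ⟨Y, hY, h⟩ := hclose p hpj rfl fun hmem => hpU (hTU j hmem)
      exact ⟨Y, hY.trans (hcolor j _), h⟩
  let L := S.filter fun p => large (c p)
  let M := S.filter fun p => ¬ large (c p)
  let M₁ := M.filter fun p => p ∈ U
  let M₂ := M.filter fun p => p ∉ U
  have hM : M₁ ∪ M₂ = M := Finset.filter_union_filter_not_eq _ _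
  have hML : M ∪ L = S := by
    rw [Finset.union_comm]
    exact Finset.filter_union_filter_not_eq _ _
  have hdM : Disjoint M₁ M₂ := Finset.disjoint_filter_filter_not _ _ _
  have hdML : Disjoint M L := (Finset.disjoint_filter_filter_not _ _ _).symm
  have hcML : M.card + L.card = ∑ i, κ i := by
    rw [← Finset.card_union_of_disjoint hdML, hML, hS.card_eq]
  have hcM : M₁.card + M₂.card = M.card := by
    rw [← Finset.card_union_of_disjoint hdM, hM]
  -- Kept points stay fixed; with `k` candidates and fewer than `k` points in use, one is always
  -- free.
  obtain ⟨f, hf₁, hf₂⟩ := exists_greedy_extension (D := fun x y : X => x ≠ y)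
    (fun _ _ h => h.symm) (n := ∑ i, κ i)
    (C := fun p y => y ∈ colorClass c U (c p) ∧ dist p y < r / 4) M₁ id M₂ hdM (by omega) (by
      intro p hp F hF
      obtain ⟨hpM, hpU⟩ := Finset.mem_filter.1 hp
      obtain ⟨hpS, hpl⟩ := Finset.mem_filter.1 hpM
      obtain ⟨Y, hYU, hYcard, hY⟩ := hsmall p hpS hpl hpU
      obtain ⟨y, hyY, hyF⟩ := Finset.exists_mem_notMem_of_card_lt_card (hF.trans_eq hYcard.symm)
      exact ⟨y, ⟨hYU hyY, hY y hyY⟩, fun z hz hyz => hyF (hyz ▸ hz)⟩)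
  -- Large colors come last, so their points avoid everything already placed.
  obtain ⟨g, hg₁, hg₂⟩ := exists_greedy_extension (D := fun x y : X => r / 8 ≤ dist x y)
    (fun x y h => by rwa [dist_comm]) (n := ∑ i, κ i)
    (C := fun p y => y ∈ colorClass c U (c p)) M f L hdML (by omega) (by
      intro p hp F hF
      obtain ⟨hpS, G, hGU, hGcard, hsep⟩ := Finset.mem_filter.1 hp
      obtain ⟨y, hyG, hy⟩ := exists_far_of_separated (F := F) (by omega) hsep
      exact ⟨y, hGU hyG, hy⟩)
  have hgM : ∀ p ∈ M, g p ∈ colorClass c U (c p) ∧ dist p (g p) < r / 4 := by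
    intro p hp
    rw [hg₁ p hp]
    by_cases hpU : p ∈ U
    · rw [hf₁ p (Finset.mem_filter.2 ⟨hp, hpU⟩), id, dist_self]
      exact ⟨mem_colorClass.2 ⟨hpU, rfl⟩, by positivity⟩
    · exact (hf₂ p (Finset.mem_filter.2 ⟨hp, hpU⟩)).1
  have hneM : ∀ p ∈ M, ∀ q ∈ M, p ≠ q → g p ≠ g q := by
    intro p hp q hq hpq
    rw [hg₁ p hp, hg₁ q hq]
    rw [← hM] at hp hq
    rcases Finset.mem_union.1 hp with hp₁ | hp₂
    · rcases Finset.mem_union.1 hq with hq₁ | hq₂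
      · rwa [hf₁ p hp₁, hf₁ q hq₁]
      · exact ((hf₂ q hq₂).2 p hp hpq).symm
    · exact (hf₂ p hp₂).2 q hq hpq.symm
  have hgL : ∀ p ∈ S, ∀ q ∈ S, p ≠ q → p ∈ L ∨ q ∈ L → r / 8 ≤ dist (g p) (g q) := by
    rintro p hp q hq hpq (h | h)
    · exact (hg₂ p h).2 q (hML.symm ▸ hq) hpq.symm
    · rw [dist_comm]
      exact (hg₂ q h).2 p (hML.symm ▸ hp) hpq
  have hmem : ∀ p ∈ S, p ∈ M ∨ p ∈ L := fun p hp => Finset.mem_union.1 (hML.symm ▸ hp)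
  have hgU : ∀ p ∈ S, g p ∈ colorClass c U (c p) := fun p hp =>
    (hmem p hp).elim (fun h => (hgM p h).1) fun h => (hg₂ p h).1
  have hinj : Set.InjOn g S := by
    intro p hp q hq hpq
    by_contra hne
    by_cases h : p ∈ L ∨ q ∈ L
    · have := hgL p hp q hq hne h
      rw [hpq, dist_self] at this
      linarith
    · push Not at h
      exact hneM p ((hmem p hp).resolve_right h.1) q ((hmem q hq).resolve_right h.2) hne hpq
  refine ⟨S.image g, hS.image hinj (fun p hp => (mem_colorClass.1 (hgU p hp)).2)
    fun p hp => (mem_colorClass.1 (hgU p hp)).1, ?_⟩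
  have hnn : ∀ p ∈ S.filter fun p => r ≤ Metric.infDist p (S.erase p : Set X),
      r / 8 ≤ Metric.infDist (g p) ((S.image g).erase (g p) : Set X) := by
    intro p hp
    obtain ⟨hpS, hpr⟩ := Finset.mem_filter.1 hp
    -- `infDist` to the empty set is `0`, below `r`.
    have hne : (S.erase p).Nonempty := by
      rw [Finset.nonempty_iff_ne_empty]
      intro h0
      have : ((S.erase p : Finset X) : Set X) = ∅ := by rw [h0, Finset.coe_empty]
      rw [this, Metric.infDist_empty] at hpr
      linarith
    have hne' : ((S.image g).erase (g p)).Nonempty := by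
      obtain ⟨q, hq⟩ := hne
      obtain ⟨hqp, hqS⟩ := Finset.mem_erase.1 hq
      exact ⟨g q, Finset.mem_erase.2
        ⟨fun h => hqp (hinj hqS hpS h), Finset.mem_image_of_mem g hqS⟩⟩
    refine (Metric.le_infDist (Finset.coe_nonempty.2 hne')).2 fun {y} hy => ?_
    obtain ⟨hyp, hyS⟩ := Finset.mem_erase.1 (Finset.mem_coe.1 hy)
    obtain ⟨q, hqS, rfl⟩ := Finset.mem_image.1 hyS
    have hpq : p ≠ q := fun h => hyp (h ▸ rfl)
    by_cases h : p ∈ L ∨ q ∈ L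
    · exact hgL p hpS q hqS hpq h
    · push Not at h
      have h1 := (hgM p ((hmem p hpS).resolve_right h.1)).2
      have h2 := (hgM q ((hmem q hqS).resolve_right h.2)).2
      have h3 : r ≤ dist p q := hpr.trans
        (Metric.infDist_le_dist_of_mem (Finset.mem_coe.2 (Finset.mem_erase.2 ⟨hpq.symm, hqS⟩)))
      have h4 := dist_triangle4 p (g p) (g q) q
      rw [dist_comm (g q) q] at h4
      -- Both endpoints move by less than `r / 4`, leaving more than `r / 2`.
      linarith
  have hsum : ({p ∈ S | r ≤ Metric.infDist p (S.erase p : Set X)}.card : ℝ) * (r / 8) ≤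
      sumNN (S.image g) := by
    rw [sumNN, Finset.sum_image hinj, ← nsmul_eq_mul]
    exact (Finset.card_nsmul_le_sum _ _ _ hnn).trans
      (Finset.sum_le_sum_of_subset_of_nonneg (Finset.filter_subset _ _)
        fun _ _ _ => Metric.infDist_nonneg)
  linarith

/-! ### Summation over thresholds -/

/-- A weak-type bound on the superlevel sets of `f` bounds its sum, up to a harmonic factor. -/
theorem sum_le_mul_harmonic {α : Type*} (S : Finset α) (f : α → ℝ) {B : ℝ}
    (hB : ∀ r, 0 < r → r * ({p ∈ S | r ≤ f p}.card : ℝ) ≤ B) (hB0 : 0 ≤ B) :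
    ∑ p ∈ S, f p ≤ B * (harmonic S.card : ℝ) := by
  classical
  induction hn : S.card generalizing S with
  | zero =>
    rw [Finset.card_eq_zero.1 hn]
    simp
  | succ n ih =>
    obtain ⟨a, ha, hmin⟩ := S.exists_min_image f (Finset.card_pos.1 (by omega))
    have hrest := ih (S.erase a) (fun r hr => le_trans (mul_le_mul_of_nonneg_left
      (Nat.cast_le.2 (Finset.card_le_card
        (Finset.filter_subset_filter _ (Finset.erase_subset a S)))) hr.le) (hB r hr))
      (by rw [Finset.card_erase_of_mem ha, hn]; rfl)
    -- At threshold `f a`, the minimum, the superlevel set is all of `S`.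
    have hfa : f a ≤ B * ((n : ℝ) + 1)⁻¹ := by
      rw [← div_eq_mul_inv, le_div_iff₀ (by positivity)]
      rcases le_or_gt (f a) 0 with h0 | h0
      · exact (mul_nonpos_of_nonpos_of_nonneg h0 (by positivity)).trans hB0
      · have := hB (f a) h0
        rw [Finset.filter_true_of_mem hmin, hn] at this
        exact_mod_cast this
    rw [← Finset.add_sum_erase S f ha, harmonic_succ]
    push_cast
    linarith

/-- Since `log 2 > 1 / 2`, the constant `1` is absorbed by `2 * log k`. -/
theorem one_add_log_le {k : ℕ} (hk : 2 ≤ k) : 1 + Real.log k ≤ 3 * Real.log k := by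
  have h1 : Real.log 2 ≤ Real.log k := Real.log_le_log (by norm_num) (by exact_mod_cast hk)
  linarith [Real.log_two_gt_d9]

/-- The single-color constructions, applied to every color class, are a fully composable core-set
with factor `O(log k)`, independently of the number of colors. -/
theorem fairDiv_biUnion_le {m : ℕ} {c : X → Fin m} {κ : Fin m → ℕ} {N : ℕ}
    {P T : Fin N → Finset X} (hT : ∀ j, UnionCoresetOutput c (∑ i, κ i) (P j) (T j))
    (hP : ∃ S, IsFairSelection c κ (univ.biUnion P) S) :
    (∃ S, IsFairSelection c κ (univ.biUnion T) S) ∧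
      fairDiv c κ (univ.biUnion P) ≤
        24 * Real.log (∑ i, κ i : ℕ) * fairDiv c κ (univ.biUnion T) := by
  obtain ⟨⟨S, hS, hSP⟩, -⟩ := fairDiv_isGreatest c κ _ hP
  have hfeas : ∃ S, IsFairSelection c κ (univ.biUnion T) S :=
    -- Any positive scale yields feasibility.
    (exists_fair_selection_of_coresets hT hS one_pos).imp fun _ h => h.1
  refine ⟨hfeas, ?_⟩
  have hub := (fairDiv_isGreatest c κ _ hfeas).2
  have h0 : 0 ≤ fairDiv c κ (univ.biUnion T) := by
    obtain ⟨S', hS'⟩ := hfeas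
    exact (sumNN_nonneg S').trans (hub ⟨S', hS', rfl⟩)
  rw [← hSP]
  rcases le_or_gt (∑ i, κ i) 1 with hk | hk
  · rw [sumNN_eq_zero_of_card_le_one (hS.card_eq.trans_le hk)]
    exact mul_nonneg (mul_nonneg (by norm_num) (Real.log_natCast_nonneg _)) h0
  have hsum : sumNN S ≤ 8 * fairDiv c κ (univ.biUnion T) * (harmonic S.card : ℝ) := by
    refine sum_le_mul_harmonic S _ (fun r hr => ?_) (by positivity)
    obtain ⟨S', hS', hle⟩ := exists_fair_selection_of_coresets hT hS hr
    exact hle.trans (mul_le_mul_of_nonneg_left (hub ⟨S', hS', rfl⟩) (by norm_num))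
  rw [hS.card_eq] at hsum
  calc sumNN S ≤ 8 * fairDiv c κ (univ.biUnion T) * (harmonic (∑ i, κ i) : ℝ) := hsum
    _ ≤ 8 * fairDiv c κ (univ.biUnion T) * (3 * Real.log (∑ i, κ i : ℕ)) :=
      mul_le_mul_of_nonneg_left ((harmonic_le_one_add_log _).trans (one_add_log_le hk))
        (by positivity)
    _ = 24 * Real.log (∑ i, κ i : ℕ) * fairDiv c κ (univ.biUnion T) := by ring

end FairDiversity

theorem mainTheorem8 :
    ∃ C₁ C₂ : ℝ, 0 < C₁ ∧ 0 < C₂ ∧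
      ∀ (X : Type*) [MetricSpace X] [DecidableEq X] (m : ℕ) (c : X → Fin m) (κ : Fin m → ℕ)
        (k : ℕ), k = ∑ i, κ i →
        (∀ P : Finset X, ∃ T, FairDiversity.UnionCoresetOutput c k P T) ∧
        (∀ P T : Finset X, FairDiversity.UnionCoresetOutput c k P T →
          T ⊆ P ∧ (T.card : ℝ) ≤ C₁ * (m * (k : ℝ) ^ 2)) ∧
        FairDiversity.IsFullyComposable c κ (FairDiversity.UnionCoresetOutput c k)
          (C₂ * (m * Real.log k)) := by
  refine ⟨2, 24, by norm_num, by norm_num, ?_⟩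
  intro X _ _ m c κ k hk
  subst hk
  refine ⟨FairDiversity.UnionCoresetOutput.exists_output c _, fun P T h => ⟨h.subset, ?_⟩, ?_⟩
  · have hk : (∑ i, κ i) * (∑ i, κ i + 1) ≤ 2 * (∑ i, κ i) ^ 2 := by
      rcases Nat.eq_zero_or_pos (∑ i, κ i) with h0 | h0
      · simp [h0]
      · nlinarith
    have hcard := h.card_le.trans (Nat.mul_le_mul_left m hk)
    calc (T.card : ℝ) ≤ ((m * (2 * (∑ i, κ i) ^ 2) : ℕ) : ℝ) := Nat.cast_le.2 hcard
      _ = 2 * (m * ((∑ i, κ i : ℕ) : ℝ) ^ 2) := by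
        rw [Nat.cast_mul, Nat.cast_mul, Nat.cast_pow]
        push_cast
        ring
  · intro N P T hT hP
    obtain ⟨hfeas, hle⟩ := FairDiversity.fairDiv_biUnion_le hT hP
    refine ⟨hfeas, hle.trans ?_⟩
    have h0 : 0 ≤ FairDiversity.fairDiv c κ (univ.biUnion T) := by
      obtain ⟨S, hS⟩ := hfeas
      exact (FairDiversity.sumNN_nonneg S).trans
        ((FairDiversity.fairDiv_isGreatest c κ _ ⟨S, hS⟩).2 ⟨S, hS, rfl⟩)
    have hlog : 0 ≤ Real.log (∑ i, κ i : ℕ) := Real.log_natCast_nonneg _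
    refine mul_le_mul_of_nonneg_right (mul_le_mul_of_nonneg_left ?_ (by norm_num)) h0
    -- The factor `m` only weakens the bound when `m ≥ 1`; for `m = 0` the sum `k` is `0`, and `log
    -- 0 = 0`.
    rcases Nat.eq_zero_or_pos m with rfl | hm
    · simp
    · exact le_mul_of_one_le_left hlog (by exact_mod_cast hm)
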